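/- Everything is $C^\infty$. Let $(M,\gamma,F)$ be a para-Hermitian manifold: $M$ is a manifold (Hausdorff, without boundary), $F\in \mathrm{End}(TM)$ satisfies $F^2=\mathrm{Id}$, its $\pm1$-eigenbundles $L,\bar L$ have equal rank and are integrable (closed under the Lie bracket, i.e. tangent to foliations), and $\gamma$ is a symmetric non degenerate $2$-covariant tensor field with $\gamma(FX,Y)=-\gamma(X,FY)$. Put $\omega(X,Y)=\gamma(X,FY)$, write $X=X_L+X_{\bar L}$ for the decomposition $TM=L\oplus\bar L$, let $\sharp_\omega$ be the inverse of $X\mapsto i(X)\omega=\omega(X,\cdot)$, let $pr_{ann\,\bar L}\,\alpha=\alpha\circ pr_L$, $pr_{ann\,L}\,\alpha=\alpha\circ pr_{\bar L}$ for $1$-forms $\alpha$, and let $\mathfrak L$ be the Lie derivative. Define products of vector fields by $$X\bigstar_{(L,\bar L)}Y=[X_L,Y_L]+\sharp_\omega pr_{ann\,\bar L}\big[\mathfrak L_{X_L}i(Y_{\bar L})\omega-\mathfrak L_{Y_L}i(X_{\bar L})\omega+d(\omega(X_{\bar L},Y_L))\big],$$ (the transfer to $TM$, by $X\mapsto (X_L,i(X_{\bar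 L})\omega)$, of the Dorfman product of the big tangent bundle $L\oplus T^*M/ann\,L$ of the foliation $L$), let $\bigstar_{(\bar L,L)}$ be the product obtained by exchanging $L$ and $\bar L$ and replacing $\omega$ by $-\omega$, and put $$\bigstar_\omega=\bigstar_{(L,\bar L)}+\bigstar_{(\bar L,L)}.$$ For a vector bundle $E\to M$ with a non degenerate (not necessarily definite) metric $g$ and a bundle morphism $\rho:E\to TM$ (the anchor), let $\partial f=\frac12\sharp_g(df\circ\rho)$, where $\sharp_g$ is the inverse of $e\mapsto g(e,\cdot)$. An $\mathbb R$-bilinear product $\bigstar:\Gamma E\times\Gamma E\to\Gamma E$ makes $(E,g,\rho,\bigstar)$ a metric algebroid if 1) $(\rho e)(g(e_1,e_2))=g(e\bigstar e_1,e_2)+g(e_1,e\bigstar e_2)$ and 2) $e\bigstar e=\partial(g(e,e))$ for all sections. The product is a Dorfman product, and $(E,g,\rho,\bigstar)$ is a Courant algebroid, if moreover the Leibniz identity 3) $e\bigstar(e_1\bigstar e_2)=(e\bigstar e_1)\bigstar e_2+e_1\bigstar(e\bigstar e_2)$ holds. Then: (a) $\bigstar_{(L,\bar L)}$ and $\bigstar_{(\bar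 L,L)}$ are Dorfman products: $(TM,\frac12\gamma,pr_L,\bigstar_{(L,\bar L)})$ and $(TM,\frac12\gamma,pr_{\bar L},\bigstar_{(\bar L,L)})$ are Courant algebroids. (b) Their sum $\bigstar_\omega$ makes $(TM,\gamma,\mathrm{Id},\bigstar_\omega)$ a metric algebroid; in particular $X\bigstar_\omega X=\frac12\,\mathrm{grad}_\gamma(\gamma(X,X))$ for every vector field $X$. (c) If $M$ is non-empty and of positive dimension, $\bigstar_\omega$ does not satisfy the Leibniz identity. -/

import Mathlib

open Bundle Manifold
open scoped Manifold ContDiff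

noncomputable section

/-! ### Metric algebroids and Courant algebroids on a vector bundle -/

section Algebroid

variable {E : Type*} [NormedAddCommGroup E] [NormedSpace ℝ E]
  {H : Type*} [TopologicalSpace H] (I : ModelWithCorners ℝ E H)
  {M : Type*} [TopologicalSpace M] [ChartedSpace H M] [IsManifold I ∞ M]
  (F : Type*) [NormedAddCommGroup F] [NormedSpace ℝ F] [FiniteDimensional ℝ F]
  {V : M → Type*} [TopologicalSpace (TotalSpace F V)]
  [∀ x, TopologicalSpace (V x)] [∀ x, AddCommGroup (V x)] [∀ x, Module ℝ (V x)]
  [∀ x, IsTopologicalAddGroup (V x)] [∀ x, ContinuousSMul ℝ (V x)]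
  [FiberBundle F V] [VectorBundle ℝ F V] [ContMDiffVectorBundle ∞ F V I]

/-- A `C^∞` section of the vector bundle `V → M`. -/
def IsSmoothSection (s : Π x : M, V x) : Prop :=
  ContMDiff I (I.prod 𝓘(ℝ, F)) ∞ (fun x ↦ TotalSpace.mk' F x (s x))

/-- `g` is a `C^∞`, symmetric, non degenerate bilinear form on the bundle `V → M`
(of arbitrary signature). -/
structure IsBundleMetric (g : Π x : M, V x →L[ℝ] V x →L[ℝ] ℝ) : Prop where
  smooth : ContMDiff I (I.prod 𝓘(ℝ, F →L[ℝ] F →L[ℝ] ℝ)) ∞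
    (fun x ↦ TotalSpace.mk' (F →L[ℝ] F →L[ℝ] ℝ) x (g x))
  symm : ∀ (x : M) (v w : V x), g x v w = g x w v
  nondegenerate : ∀ (x : M) (v : V x), (∀ w : V x, g x v w = 0) → v = 0

variable {F}

/-- The map `♯_b`, inverse of `♭_b : v ↦ b(v, ·)`, of a field `b` of non degenerate bilinear
forms on a bundle of finite rank. -/
def sharp (b : Π x : M, V x →L[ℝ] V x →L[ℝ] ℝ) (x : M) (α : V x →L[ℝ] ℝ) : V x :=
  (b x).inverse α

/-- `∂ f = (1/2) ♯_g (ᵗρ (df))`. -/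
def algebroidD (g : Π x : M, V x →L[ℝ] V x →L[ℝ] ℝ)
    (ρ : Π x : M, V x →L[ℝ] TangentSpace I x) (f : M → ℝ) (x : M) : V x :=
  (1 / 2 : ℝ) • sharp g x ((mvfderiv I f x).comp (ρ x))

variable (F)

/-- `(V, g, ρ, star)` is a metric algebroid: `g` is a metric on the bundle `V`, the anchor
`ρ : V → TM` is a bundle morphism, and `star` is an `ℝ`-bilinear operation on the
`C^∞` sections of `V` satisfying the compatibility and the normalization axioms.
(`star` is given as an operation on all sections; only its values on `C^∞` sections matter.) -/
structure IsMetricAlgebroid (g : Π x : M, V x →L[ℝ] V x →L[ℝ] ℝ)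
    (ρ : Π x : M, V x →L[ℝ] TangentSpace I x)
    (star : (Π x : M, V x) → (Π x : M, V x) → (Π x : M, V x)) : Prop where
  metric : IsBundleMetric I F g
  anchor_smooth : ContMDiff I (I.prod 𝓘(ℝ, F →L[ℝ] E)) ∞
    (fun x ↦ TotalSpace.mk' (F →L[ℝ] E) (E := fun x ↦ V x →L[ℝ] TangentSpace I x) x (ρ x))
  star_smooth : ∀ a b, IsSmoothSection I F a → IsSmoothSection I F b →
    IsSmoothSection I F (star a b)
  star_add_left : ∀ a a' b, IsSmoothSection I F a → IsSmoothSection I F a' →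
    IsSmoothSection I F b → star (a + a') b = star a b + star a' b
  star_add_right : ∀ a b b', IsSmoothSection I F a → IsSmoothSection I F b →
    IsSmoothSection I F b' → star a (b + b') = star a b + star a b'
  star_smul_left : ∀ (c : ℝ) a b, IsSmoothSection I F a → IsSmoothSection I F b →
    star (c • a) b = c • star a b
  star_smul_right : ∀ (c : ℝ) a b, IsSmoothSection I F a → IsSmoothSection I F b →
    star a (c • b) = c • star a b
  compatible : ∀ e a b, IsSmoothSection I F e → IsSmoothSection I F a → IsSmoothSection I F b →
    ∀ x, mvfderiv I (fun y ↦ g y (a y) (b y)) x (ρ x (e x))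
      = g x (star e a x) (b x) + g x (a x) (star e b x)
  normalized : ∀ e, IsSmoothSection I F e →
    ∀ x, star e e x = algebroidD I g ρ (fun y ↦ g y (e y) (e y)) x

/-- The Leibniz axiom `e ★ (a ★ b) = (e ★ a) ★ b + a ★ (e ★ b)` on `C^∞` sections. -/
def SatisfiesLeibniz (star : (Π x : M, V x) → (Π x : M, V x) → (Π x : M, V x)) : Prop :=
  ∀ e a b, IsSmoothSection I F e → IsSmoothSection I F a → IsSmoothSection I F b →
    star e (star a b) = star (star e a) b + star a (star e b)

/-- `(V, g, ρ, star)` is a Courant algebroid, i.e. `star` is a Dorfman bracket. -/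
structure IsCourantAlgebroid (g : Π x : M, V x →L[ℝ] V x →L[ℝ] ℝ)
    (ρ : Π x : M, V x →L[ℝ] TangentSpace I x)
    (star : (Π x : M, V x) → (Π x : M, V x) → (Π x : M, V x)) : Prop where
  metricAlgebroid : IsMetricAlgebroid I F g ρ star
  leibniz : SatisfiesLeibniz I F star

end Algebroid

/-! ### Para-Hermitian manifolds -/

section ParaHermitian

variable {E : Type*} [NormedAddCommGroup E] [NormedSpace ℝ E] [FiniteDimensional ℝ E]
  {H : Type*} [TopologicalSpace H] (I : ModelWithCorners ℝ E H)
  {M : Type*} [TopologicalSpace M] [ChartedSpace H M] [IsManifold I ∞ M]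

/-- A `C^∞` vector field. -/
abbrev IsSmoothField (X : Π x : M, TangentSpace I x) : Prop :=
  IsSmoothSection I E X

variable {I}

/-- The fibre at `x` of the eigenbundle of `F` with eigenvalue `c`. -/
def eigenFibre (F : Π x : M, TangentSpace I x →L[ℝ] TangentSpace I x) (c : ℝ) (x : M) :
    Submodule ℝ (TangentSpace I x) :=
  Module.End.eigenspace (F x : TangentSpace I x →ₗ[ℝ] TangentSpace I x) c

variable (I)

/-- The eigenbundle of `F` with eigenvalue `c` is integrable: its `C^∞` sections are closed
under the Lie bracket. -/
def IsIntegrableEigenbundle (F : Π x : M, TangentSpace I x →L[ℝ] TangentSpace I x)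
    (c : ℝ) : Prop :=
  ∀ X Y : Π x : M, TangentSpace I x, IsSmoothField I X → IsSmoothField I Y →
    (∀ x, X x ∈ eigenFibre F c x) → (∀ x, Y x ∈ eigenFibre F c x) →
    ∀ x, VectorField.mlieBracket I X Y x ∈ eigenFibre F c x

/-- `(γ, F)` is a para-Hermitian structure on `M`: `F` is an almost para-complex structure
(`F² = Id`, eigenbundles `L`, `L̄` for `±1` of equal rank), `γ` is a compatible neutral metric,
and both eigenbundles are integrable. -/
structure IsParaHermitian (γ : Π x : M, TangentSpace I x →L[ℝ] TangentSpace I x →L[ℝ] ℝ)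
    (F : Π x : M, TangentSpace I x →L[ℝ] TangentSpace I x) : Prop where
  metric : IsBundleMetric I E γ
  F_smooth : ContMDiff I (I.prod 𝓘(ℝ, E →L[ℝ] E)) ∞
    (fun x ↦ TotalSpace.mk' (E →L[ℝ] E)
      (E := fun x ↦ TangentSpace I x →L[ℝ] TangentSpace I x) x (F x))
  F_sq : ∀ (x : M) (v : TangentSpace I x), F x (F x v) = v
  equal_rank : ∀ x : M,
    Module.finrank ℝ (eigenFibre F 1 x) = Module.finrank ℝ (eigenFibre F (-1) x)
  F_skew : ∀ (x : M) (v w : TangentSpace I x), γ x (F x v) w = -γ x v (F x w)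
  integrable_pos : IsIntegrableEigenbundle I F 1
  integrable_neg : IsIntegrableEigenbundle I F (-1)

variable {I}

/-- The fundamental form `ω(X, Y) = γ(X, F Y)`. -/
def fundamentalForm (γ : Π x : M, TangentSpace I x →L[ℝ] TangentSpace I x →L[ℝ] ℝ)
    (F : Π x : M, TangentSpace I x →L[ℝ] TangentSpace I x) (x : M) :
    TangentSpace I x →L[ℝ] TangentSpace I x →L[ℝ] ℝ :=
  (ContinuousLinearMap.precomp ℝ (F x)).comp (γ x)

/-- The projection of `TM = L ⊕ L̄` onto the `+1`-eigenbundle `L`. -/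
def prL (F : Π x : M, TangentSpace I x →L[ℝ] TangentSpace I x) (x : M) :
    TangentSpace I x →L[ℝ] TangentSpace I x :=
  (1 / 2 : ℝ) • (ContinuousLinearMap.id ℝ (TangentSpace I x) + F x)

/-- The projection of `TM = L ⊕ L̄` onto the `-1`-eigenbundle `L̄`. -/
def prLbar (F : Π x : M, TangentSpace I x →L[ℝ] TangentSpace I x) (x : M) :
    TangentSpace I x →L[ℝ] TangentSpace I x :=
  (1 / 2 : ℝ) • (ContinuousLinearMap.id ℝ (TangentSpace I x) - F x)

variable (I) in
/-- The gradient of a function with respect to a metric. -/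
def metricGrad (γ : Π x : M, TangentSpace I x →L[ℝ] TangentSpace I x →L[ℝ] ℝ)
    (f : M → ℝ) (x : M) : TangentSpace I x :=
  sharp γ x (mvfderiv I f x)

/-! ### Dorfman products of the two foliations -/

variable (I) in
open Classical in
/-- The Lie derivative `𝔏_X α` of a `1`-form: the value at `x` is the covector characterized by
`(𝔏_X α)(Z) = X(α(Z)) - α([X, Z])` for all vector fields `Z`. The right-hand side is tensorial
in `Z` whenever `X` and `α` are differentiable; the value is `0` if it is not tensorial. -/
def lieDerivForm (X : Π x : M, TangentSpace I x) (α : Π x : M, TangentSpace I x →L[ℝ] ℝ)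
    (x : M) : TangentSpace I x →L[ℝ] ℝ :=
  haveI : IsManifold I (1 + 1) M := IsManifold.of_le (n := ∞) (by norm_cast)
  if h : TensorialAt I E (fun Z : Π x : M, TangentSpace I x ↦
      mvfderiv I (fun y ↦ α y (Z y)) x (X x) - α x (VectorField.mlieBracket I X Z x)) x
  then TensorialAt.mkHom _ x h
  else 0

variable (I) in
/-- The `1`-form component `𝔏_{Y₁} α₂ - 𝔏_{Y₂} α₁ + d(α₁(Y₂))` of the Dorfman product
`(Y₁, α₁) ★ (Y₂, α₂)`; its vector component is `[Y₁, Y₂]`. -/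
def dorfmanForm (Y₁ : Π x : M, TangentSpace I x) (α₁ : Π x : M, TangentSpace I x →L[ℝ] ℝ)
    (Y₂ : Π x : M, TangentSpace I x) (α₂ : Π x : M, TangentSpace I x →L[ℝ] ℝ)
    (x : M) : TangentSpace I x →L[ℝ] ℝ :=
  lieDerivForm I Y₁ α₂ x - lieDerivForm I Y₂ α₁ x + mvfderiv I (fun y ↦ α₁ y (Y₂ y)) x

variable (I) in
/-- Let `TM = P ⊕ Q` with projections `p`, `q`, where `P` is tangent to a foliation, and let the
`2`-form `Ω` pair `P` and `Q`. The Dorfman product of the big tangent bundle `P ⊕ T*M/ann P` of the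
foliation is transferred to `TM` by `X ↦ (p X, i(q X)Ω)` and `(Y, α) ↦ Y + ♯_Ω(pr_{ann Q} α)`;
here `pr_{ann Q} α = α ∘ p` for the decomposition `T*M = ann P ⊕ ann Q`. -/
def transferredDorfman (Ω : Π x : M, TangentSpace I x →L[ℝ] TangentSpace I x →L[ℝ] ℝ)
    (p q : Π x : M, TangentSpace I x →L[ℝ] TangentSpace I x)
    (X Y : Π x : M, TangentSpace I x) (x : M) : TangentSpace I x :=
  VectorField.mlieBracket I (fun y ↦ p y (X y)) (fun y ↦ p y (Y y)) x
    + sharp Ω x ((dorfmanForm I (fun y ↦ p y (X y)) (fun y ↦ Ω y (q y (X y)))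
        (fun y ↦ p y (Y y)) (fun y ↦ Ω y (q y (Y y))) x).comp (p x))

variable (I) in
/-- The product `★_{(L, L̄)}` defined by the foliation `L`. -/
def dorfmanL (γ : Π x : M, TangentSpace I x →L[ℝ] TangentSpace I x →L[ℝ] ℝ)
    (F : Π x : M, TangentSpace I x →L[ℝ] TangentSpace I x)
    (X Y : Π x : M, TangentSpace I x) : Π x : M, TangentSpace I x :=
  transferredDorfman I (fundamentalForm γ F) (prL F) (prLbar F) X Y

variable (I) in
/-- The product `★_{(L̄, L)}` defined by the foliation `L̄`: `L` and `L̄` are exchanged and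
`ω` is replaced by `-ω`. -/
def dorfmanLbar (γ : Π x : M, TangentSpace I x →L[ℝ] TangentSpace I x →L[ℝ] ℝ)
    (F : Π x : M, TangentSpace I x →L[ℝ] TangentSpace I x)
    (X Y : Π x : M, TangentSpace I x) : Π x : M, TangentSpace I x :=
  transferredDorfman I (fun x ↦ -fundamentalForm γ F x) (prLbar F) (prL F) X Y

variable (I) in
/-- The product `★_ω = ★_{(L, L̄)} + ★_{(L̄, L)}`. -/
def starOmega (γ : Π x : M, TangentSpace I x →L[ℝ] TangentSpace I x →L[ℝ] ℝ)
    (F : Π x : M, TangentSpace I x →L[ℝ] TangentSpace I x)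
    (X Y : Π x : M, TangentSpace I x) : Π x : M, TangentSpace I x :=
  dorfmanL I γ F X Y + dorfmanLbar I γ F X Y

end ParaHermitian

end

/-!
The product `★_{(L, L̄)}` is understood through two quantities. Its `L`-component is `[X_L, Y_L]`
(`IsParaHermitian.fieldL_dorfmanL`), and since `L` and `L̄` are isotropic and `ω = γ` on `L̄ × L`,
its remaining component is seen by pairing with sections `W` of `L`, where
(`IsParaHermitian.pairing_dorfmanL`)
`γ(X ★ Y, W) = X_L γ(Y, W) - γ(Y, [X_L, W]) - Y_L γ(X, W) + γ(X, [Y_L, W]) + W γ(X, Y_L)`.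
Here integrability of `L` makes all brackets sections of `L` again. The right-hand side involves
only global fields, so invariance of the metric, the normalization and the Leibniz identity are
formal consequences of `[X, Y] f = X Y f - Y X f` and of the Jacobi identity. The product
`★_{(L̄, L)}` is `★_{(L, L̄)}` for the para-Hermitian structure `(γ, -F)`, so nothing has to be
repeated for it.

These identities have content only for `C^∞` fields, so one needs that products of `C^∞` fields
are `C^∞`. As their pairings with `C^∞` fields are `C^∞` functions by the above formula, this
follows by inverting the Gram matrix of a local frame (`isSmoothField_of_pairing`).

For the sum `★_ω` the axioms of a metric algebroid add up, because `pr_L + pr_L̄ = Id`. If it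
satisfied the Leibniz identity, then `(X ★ X) ★ Y = 0`, and invariance of the metric would give
`d(γ(Y, Y))(grad γ(X, X)) = 0` for all `X`, `Y`. But the differential of `γ(X, X)` at a point can be
any covector (`IsParaHermitian.exists_mvfderiv_pairing_self_eq`), which contradicts
non-degeneracy of `γ` in positive dimension.
-/

open Bundle Manifold
open scoped Manifold ContDiff

noncomputable section

/-! ### Derivatives along vector fields, brackets, and global extensions -/

section Fields

variable {E : Type*} [NormedAddCommGroup E] [NormedSpace ℝ E]
  {H : Type*} [TopologicalSpace H] {I : ModelWithCorners ℝ E H}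
  {M : Type*} [TopologicalSpace M] [ChartedSpace H M]

variable (I) in
/-- The derivative `X f` of a function `f` along a vector field `X`. -/
def dirDeriv (X : Π x : M, TangentSpace I x) (f : M → ℝ) (x : M) : ℝ :=
  mvfderiv I f x (X x)

theorem dirDeriv_add (X : Π x : M, TangentSpace I x) {f g : M → ℝ} {x : M}
    (hf : MDifferentiableAt I 𝓘(ℝ) f x) (hg : MDifferentiableAt I 𝓘(ℝ) g x) :
    dirDeriv I X (f + g) x = dirDeriv I X f x + dirDeriv I X g x := by
  simp only [dirDeriv, mvfderiv_add hf hg]; rfl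

theorem dirDeriv_sub (X : Π x : M, TangentSpace I x) {f g : M → ℝ} {x : M}
    (hf : MDifferentiableAt I 𝓘(ℝ) f x) (hg : MDifferentiableAt I 𝓘(ℝ) g x) :
    dirDeriv I X (f - g) x = dirDeriv I X f x - dirDeriv I X g x := by
  simp only [dirDeriv, mvfderiv_sub hf hg]; rfl

theorem dirDeriv_mul (X : Π x : M, TangentSpace I x) {f g : M → ℝ} {x : M}
    (hf : MDifferentiableAt I 𝓘(ℝ) f x) (hg : MDifferentiableAt I 𝓘(ℝ) g x) :
    dirDeriv I X (f * g) x = f x * dirDeriv I X g x + g x * dirDeriv I X f x := by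
  simp only [dirDeriv, mvfderiv_mul hf hg]; rfl

theorem dirDeriv_const_mul (X : Π x : M, TangentSpace I x) (c : ℝ) {f : M → ℝ} {x : M}
    (hf : MDifferentiableAt I 𝓘(ℝ) f x) :
    dirDeriv I X (fun y ↦ c * f y) x = c * dirDeriv I X f x := by
  have h := dirDeriv_mul X (f := fun _ ↦ c) mdifferentiableAt_const hf
  have h0 : dirDeriv I X (fun _ : M ↦ c) x = 0 := by
    rw [dirDeriv, mvfderiv_const]; rfl
  rw [h0, mul_zero, add_zero] at h
  exact h

theorem dirDeriv_add_field (X Y : Π x : M, TangentSpace I x) (f : M → ℝ) (x : M) :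
    dirDeriv I (X + Y) f x = dirDeriv I X f x + dirDeriv I Y f x :=
  map_add (mvfderiv I f x) (X x) (Y x)

theorem dirDeriv_smul_field (c : ℝ) (X : Π x : M, TangentSpace I x) (f : M → ℝ) (x : M) :
    dirDeriv I (c • X) f x = c * dirDeriv I X f x :=
  map_smul (mvfderiv I f x) c (X x)

theorem ContMDiff.mdiffAt {f : M → ℝ} (hf : ContMDiff I 𝓘(ℝ) ∞ f) (x : M) :
    MDifferentiableAt I 𝓘(ℝ) f x :=
  hf.mdifferentiableAt (by simp)

/-- Smoothness of combinations of the shape that occurs in `IsParaHermitian.pairing_dorfmanL`. -/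
theorem contMDiff_sub_sub_add_add {a b c d e : M → ℝ} (ha : ContMDiff I 𝓘(ℝ) ∞ a)
    (hb : ContMDiff I 𝓘(ℝ) ∞ b) (hc : ContMDiff I 𝓘(ℝ) ∞ c) (hd : ContMDiff I 𝓘(ℝ) ∞ d)
    (he : ContMDiff I 𝓘(ℝ) ∞ e) : ContMDiff I 𝓘(ℝ) ∞ (a - b - c + d + e) :=
  (((ha.sub hb).sub hc).add hd).add he

theorem dirDeriv_sub_sub_add_add (X : Π x : M, TangentSpace I x) {a b c d e : M → ℝ}
    (ha : ContMDiff I 𝓘(ℝ) ∞ a) (hb : ContMDiff I 𝓘(ℝ) ∞ b) (hc : ContMDiff I 𝓘(ℝ) ∞ c)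
    (hd : ContMDiff I 𝓘(ℝ) ∞ d) (he : ContMDiff I 𝓘(ℝ) ∞ e) (x : M) :
    dirDeriv I X (a - b - c + d + e) x = dirDeriv I X a x - dirDeriv I X b x
      - dirDeriv I X c x + dirDeriv I X d x + dirDeriv I X e x := by
  have hab : ContMDiff I 𝓘(ℝ) ∞ (a - b) := ha.sub hb
  have habc : ContMDiff I 𝓘(ℝ) ∞ (a - b - c) := hab.sub hc
  have habcd : ContMDiff I 𝓘(ℝ) ∞ (a - b - c + d) := habc.add hd
  rw [dirDeriv_add X (habcd.mdiffAt x) (he.mdiffAt x), dirDeriv_add X (habc.mdiffAt x)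
    (hd.mdiffAt x), dirDeriv_sub X (hab.mdiffAt x) (hc.mdiffAt x),
    dirDeriv_sub X (ha.mdiffAt x) (hb.mdiffAt x)]

variable [IsManifold I ∞ M]

theorem IsSmoothSection.mdiffAt {X : Π x : M, TangentSpace I x} (hX : IsSmoothField I X) (x : M) :
    MDifferentiableAt I (I.prod 𝓘(ℝ, E)) (fun y ↦ TotalSpace.mk' E y (X y)) x :=
  ContMDiff.mdifferentiableAt (n := ∞) hX (by simp)

theorem contMDiff_dirDeriv {X : Π x : M, TangentSpace I x} (hX : IsSmoothField I X)
    {f : M → ℝ} (hf : ContMDiff I 𝓘(ℝ) ∞ f) : ContMDiff I 𝓘(ℝ) ∞ (dirDeriv I X f) := by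
  have h := (hf.contMDiff_tangentMap (m := ∞) (by simp)).comp hX
  exact (contMDiff_snd_tangentBundle_modelSpace ℝ 𝓘(ℝ)).comp h

theorem isSmoothField_smul {f : M → ℝ} (hf : ContMDiff I 𝓘(ℝ) ∞ f)
    {X : Π x : M, TangentSpace I x} (hX : IsSmoothField I X) : IsSmoothField I (f • X) :=
  ContMDiff.smul_section hf hX

theorem isSmoothField_add {X Y : Π x : M, TangentSpace I x} (hX : IsSmoothField I X)
    (hY : IsSmoothField I Y) : IsSmoothField I (X + Y) :=
  ContMDiff.add_section hX hY

theorem isSmoothField_const_smul (c : ℝ) {X : Π x : M, TangentSpace I x}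
    (hX : IsSmoothField I X) : IsSmoothField I (c • X) :=
  ContMDiff.const_smul_section hX

variable [FiniteDimensional ℝ E]

theorem isSmoothField_mlieBracket {X Y : Π x : M, TangentSpace I x}
    (hX : IsSmoothField I X) (hY : IsSmoothField I Y) :
    IsSmoothField I (VectorField.mlieBracket I X Y) := by
  have : CompleteSpace E := FiniteDimensional.complete ℝ E
  have : IsManifold I ((⊤ : ℕ∞) + 1) M := by simpa using ‹IsManifold I ∞ M›
  have : IsManifold I (minSmoothness ℝ 2) M := by
    simp only [minSmoothness_of_isRCLikeNormedField]; infer_instance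
  exact ContDiff.mlieBracket_vectorField (m := ⊤) (n := ⊤) hX hY (by simp)

theorem mlieBracket_jacobi {X Y Z : Π x : M, TangentSpace I x}
    (hX : IsSmoothField I X) (hY : IsSmoothField I Y) (hZ : IsSmoothField I Z) (x : M) :
    VectorField.mlieBracket I X (VectorField.mlieBracket I Y Z) x =
      VectorField.mlieBracket I (VectorField.mlieBracket I X Y) Z x
      + VectorField.mlieBracket I Y (VectorField.mlieBracket I X Z) x := by
  have : CompleteSpace E := FiniteDimensional.complete ℝ E
  have : IsManifold I (minSmoothness ℝ 3) M := by
    simp only [minSmoothness_of_isRCLikeNormedField]; infer_instance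
  have h2 : minSmoothness ℝ 2 ≤ (∞ : WithTop ℕ∞) := by
    simp only [minSmoothness_of_isRCLikeNormedField]; norm_cast
  exact VectorField.leibniz_identity_mlieBracket_apply
    (ContMDiff.contMDiffAt (hX.of_le h2)) (ContMDiff.contMDiffAt (hY.of_le h2))
    (ContMDiff.contMDiffAt (hZ.of_le h2))

theorem mlieBracket_fun_smul {X Y : Π x : M, TangentSpace I x} (hY : IsSmoothField I Y)
    {f : M → ℝ} (hf : ContMDiff I 𝓘(ℝ) ∞ f) :
    VectorField.mlieBracket I X (f • Y) =
      dirDeriv I X f • Y + f • VectorField.mlieBracket I X Y := by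
  have : CompleteSpace E := FiniteDimensional.complete ℝ E
  ext x
  exact VectorField.mlieBracket_smul_right (hf.mdiffAt x) (hY.mdiffAt x)

variable [T2Space M]

/-- A field which is `C^∞` on the source of the preferred chart at `x₀` agrees near `x₀` with a
global `C^∞` field. -/
theorem exists_isSmoothField_eventuallyEq {x₀ : M} {s : Π x : M, TangentSpace I x}
    (hs : ContMDiffOn I (I.prod 𝓘(ℝ, E)) ∞ (fun x ↦ TotalSpace.mk' E x (s x))
      (chartAt H x₀).source) :
    ∃ Z : Π x : M, TangentSpace I x, IsSmoothField I Z ∧ ∀ᶠ x in nhds x₀, Z x = s x := by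
  obtain ⟨ψ⟩ : Nonempty (SmoothBumpFunction I x₀) := inferInstance
  refine ⟨(ψ : M → ℝ) • s, ?_, ?_⟩
  · exact ContMDiffOn.smul_section_of_tsupport ψ.contMDiff.contMDiffOn (chartAt H x₀).open_source
      ψ.tsupport_subset_chartAt_source hs
  · filter_upwards [ψ.eventuallyEq_one] with x hx
    simp [hx]

/-- Near every point there is a frame of the tangent bundle by global `C^∞` fields. -/
theorem exists_frame (x₀ : M) :
    ∃ (n : ℕ) (Z : Fin n → Π x : M, TangentSpace I x), (∀ i, IsSmoothField I (Z i)) ∧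
      ∀ᶠ x in nhds x₀, LinearIndependent ℝ (fun i ↦ Z i x) ∧
        ⊤ ≤ Submodule.span ℝ (Set.range fun i ↦ Z i x) := by
  let e := trivializationAt E (TangentSpace I) x₀
  let b := Module.finBasis ℝ E
  have hfr := e.isLocalFrameOn_localFrame_baseSet I ∞ b
  have key := fun i ↦ exists_isSmoothField_eventuallyEq (x₀ := x₀) (hfr.contMDiffOn i)
  choose Z hZ hZe using key
  refine ⟨_, Z, hZ, ?_⟩
  have hb : e.baseSet ∈ nhds x₀ :=
    e.open_baseSet.mem_nhds (FiberBundle.mem_baseSet_trivializationAt' x₀)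
  filter_upwards [Filter.eventually_all.2 hZe, hb] with x hx hxb
  simp only [hx]
  exact ⟨hfr.linearIndependent hxb, hfr.generating hxb⟩

theorem exists_isSmoothField_apply_eq (x₀ : M) (v : TangentSpace I x₀) :
    ∃ Z : Π x : M, TangentSpace I x, IsSmoothField I Z ∧ Z x₀ = v := by
  obtain ⟨n, Z, hZ, he⟩ := exists_frame (I := I) x₀
  have hv : v ∈ Submodule.span ℝ (Set.range fun i ↦ Z i x₀) := he.self_of_nhds.2 trivial
  obtain ⟨c, hc⟩ := (Submodule.mem_span_range_iff_exists_fun ℝ).1 hv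
  refine ⟨fun x ↦ ∑ i, (c i • Z i) x, ?_, hc⟩
  exact ContMDiff.sum_section fun i _ ↦ isSmoothField_const_smul (c i) (hZ i)

/-- The bracket of vector fields is the commutator of the derivations. It follows from the
Jacobi identity for `X`, `Y` and `f Z`, where `Z` is any field not vanishing at the point. -/
theorem dirDeriv_mlieBracket {X Y : Π x : M, TangentSpace I x}
    (hX : IsSmoothField I X) (hY : IsSmoothField I Y) {f : M → ℝ}
    (hf : ContMDiff I 𝓘(ℝ) ∞ f) (x : M) :
    dirDeriv I (VectorField.mlieBracket I X Y) f x =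
      dirDeriv I X (dirDeriv I Y f) x - dirDeriv I Y (dirDeriv I X f) x := by
  rcases subsingleton_or_nontrivial E with hE | hE
  · have h0 (v : TangentSpace I x) : v = 0 := Subsingleton.elim (α := E) v 0
    simp only [dirDeriv]
    rw [h0 (VectorField.mlieBracket I X Y x), h0 (X x), h0 (Y x)]
    simp
  · obtain ⟨v, hv⟩ := exists_ne (0 : E)
    obtain ⟨Z, hZ, hZx⟩ := exists_isSmoothField_apply_eq (I := I) x (v : TangentSpace I x)
    have hXf := contMDiff_dirDeriv hX hf
    have hYf := contMDiff_dirDeriv hY hf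
    have hXZ := isSmoothField_mlieBracket hX hZ
    have hYZ := isSmoothField_mlieBracket hY hZ
    have : CompleteSpace E := FiniteDimensional.complete ℝ E
    have J := mlieBracket_jacobi hX hY (isSmoothField_smul hf hZ) x
    have J' := mlieBracket_jacobi hX hY hZ x
    rw [mlieBracket_fun_smul hZ hf, mlieBracket_fun_smul hZ hf, mlieBracket_fun_smul hZ hf,
      VectorField.mlieBracket_add_right ((isSmoothField_smul hYf hZ).mdiffAt x)
        ((isSmoothField_smul hf hYZ).mdiffAt x),
      VectorField.mlieBracket_add_right ((isSmoothField_smul hXf hZ).mdiffAt x)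
        ((isSmoothField_smul hf hXZ).mdiffAt x),
      mlieBracket_fun_smul hZ hXf, mlieBracket_fun_smul hZ hYf,
      mlieBracket_fun_smul hXZ hf, mlieBracket_fun_smul hYZ hf] at J
    simp only [Pi.add_apply, Pi.smul_apply', J'] at J
    have : (dirDeriv I (VectorField.mlieBracket I X Y) f x -
      (dirDeriv I X (dirDeriv I Y f) x - dirDeriv I Y (dirDeriv I X f) x)) • Z x = 0 := by
      linear_combination (norm := module) (-1 : ℝ) • J
    rcases smul_eq_zero.1 this with h | h
    · linarith
    · exact absurd (hZx.symm.trans h) hv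

/-- Every covector at a point is the differential of a global `C^∞` function. -/
theorem exists_mvfderiv_eq (x₀ : M) (α : TangentSpace I x₀ →L[ℝ] ℝ) :
    ∃ f : M → ℝ, ContMDiff I 𝓘(ℝ) ∞ f ∧ f x₀ = 0 ∧ mvfderiv I f x₀ = α := by
  obtain ⟨ψ⟩ : Nonempty (SmoothBumpFunction I x₀) := inferInstance
  let φ : E →L[ℝ] ℝ := α
  let y₀ := extChartAt I x₀ x₀
  let f : M → ℝ := fun x ↦ ψ x • φ (extChartAt I x₀ x - y₀)
  have hf : ContMDiff I 𝓘(ℝ) ∞ f := by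
    refine ψ.contMDiff_smul ?_
    have h : ContDiff ℝ ∞ fun y : E ↦ φ (y - y₀) := by fun_prop
    exact h.contMDiff.comp_contMDiffOn contMDiffOn_extChartAt
  refine ⟨f, hf, by simp [f, y₀], ?_⟩
  rw [(hf.mdiffAt x₀).mvfderiv]
  have h1 : writtenInExtChartAt I 𝓘(ℝ) x₀ f =ᶠ[nhdsWithin y₀ (Set.range I)]
      fun y ↦ φ (y - y₀) := by
    have hψ : ∀ᶠ y in nhdsWithin y₀ (Set.range I), ψ ((extChartAt I x₀).symm y) = 1 := by
      have hc := map_extChartAt_symm_nhdsWithin_range (I := I) x₀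
      have h := ψ.eventuallyEq_one
      rw [← hc] at h
      exact h
    filter_upwards [extChartAt_target_mem_nhdsWithin x₀, hψ] with y hy hy1
    change f ((extChartAt I x₀).symm y) = φ (y - y₀)
    simp only [f, hy1, (extChartAt I x₀).right_inv hy, one_smul]
  have h2 : writtenInExtChartAt I 𝓘(ℝ) x₀ f y₀ = φ (y₀ - y₀) := by
    change f ((extChartAt I x₀).symm y₀) = _
    simp [f, y₀]
  have h3 : fderivWithin ℝ (writtenInExtChartAt I 𝓘(ℝ) x₀ f) (Set.range I) y₀ = φ := by
    have hu : UniqueDiffWithinAt ℝ (Set.range I) y₀ := I.uniqueDiffWithinAt_image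
    rw [h1.fderivWithin_eq h2, fderivWithin_eq_fderiv hu (by fun_prop),
      fderiv_comp_sub, φ.fderiv]
  exact h3

end Fields

/-! ### Pairings with a non-degenerate metric -/

section Metric

variable {E : Type*} [NormedAddCommGroup E] [NormedSpace ℝ E]
  {H : Type*} [TopologicalSpace H] {I : ModelWithCorners ℝ E H}
  {M : Type*} [TopologicalSpace M] [ChartedSpace H M]
  {γ : Π x : M, TangentSpace I x →L[ℝ] TangentSpace I x →L[ℝ] ℝ}

/-- The function `γ(X, Y)`. -/
def pairing (γ : Π x : M, TangentSpace I x →L[ℝ] TangentSpace I x →L[ℝ] ℝ)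
    (X Y : Π x : M, TangentSpace I x) (x : M) : ℝ :=
  γ x (X x) (Y x)

theorem pairing_add_left (X X' Y : Π x : M, TangentSpace I x) :
    pairing γ (X + X') Y = pairing γ X Y + pairing γ X' Y := by
  ext x; simp [pairing]

theorem pairing_add_right (X Y Y' : Π x : M, TangentSpace I x) :
    pairing γ X (Y + Y') = pairing γ X Y + pairing γ X Y' := by
  ext x; simp [pairing]

theorem pairing_smul_left (c : ℝ) (X Y : Π x : M, TangentSpace I x) :
    pairing γ (c • X) Y = fun x ↦ c * pairing γ X Y x := by
  ext x; simp [pairing]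

theorem pairing_smul_right (c : ℝ) (X Y : Π x : M, TangentSpace I x) :
    pairing γ X (c • Y) = fun x ↦ c * pairing γ X Y x := by
  ext x; simp [pairing]

section Sharp

variable [FiniteDimensional ℝ E]

theorem isInvertible_of_nondegenerate {B : E →L[ℝ] E →L[ℝ] ℝ}
    (hB : ∀ v, (∀ w, B v w = 0) → v = 0) : B.IsInvertible := by
  have hinj : Function.Injective (B : E →ₗ[ℝ] E →L[ℝ] ℝ) :=
    (injective_iff_map_eq_zero _).2 fun v hv ↦ hB v fun w ↦ by
      change (B : E →ₗ[ℝ] E →L[ℝ] ℝ) v w = 0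
      rw [hv]; rfl
  have hdim : Module.finrank ℝ E = Module.finrank ℝ (E →L[ℝ] ℝ) := by
    rw [← (LinearMap.toContinuousLinearMap (𝕜 := ℝ) (E := E) (F' := ℝ)).finrank_eq]
    exact Subspace.dual_finrank_eq.symm
  exact ⟨(LinearEquiv.ofInjectiveOfFinrankEq (B : E →ₗ[ℝ] E →L[ℝ] ℝ) hinj
    hdim).toContinuousLinearEquiv, by ext; rfl⟩

theorem apply_sharp {x : M} (hγ : ∀ v : TangentSpace I x, (∀ w, γ x v w = 0) → v = 0)
    (α : TangentSpace I x →L[ℝ] ℝ) : γ x (sharp γ x α) = α := by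
  have h : (γ x).IsInvertible := isInvertible_of_nondegenerate (E := E) hγ
  exact h.self_apply_inverse α

end Sharp

variable [IsManifold I ∞ M]

theorem contMDiff_pairing (hγ : IsBundleMetric I E γ) {X Y : Π x : M, TangentSpace I x}
    (hX : IsSmoothField I X) (hY : IsSmoothField I Y) : ContMDiff I 𝓘(ℝ) ∞ (pairing γ X Y) := by
  intro x
  have h : ContMDiffAt I (I.prod 𝓘(ℝ)) ∞
      (fun m ↦ TotalSpace.mk' ℝ (E := Bundle.Trivial M ℝ) m (γ m (X m) (Y m))) x :=
    ContMDiffAt.clm_bundle_apply₂ (F₁ := E) (F₂ := E) (hγ.smooth x) (hX x) (hY x)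
  simp only [contMDiffAt_totalSpace] at h
  exact h.2

theorem mdifferentiableAt_pairing (hγ : IsBundleMetric I E γ) {X Y : Π x : M, TangentSpace I x}
    {x : M} (hX : MDifferentiableAt I (I.prod 𝓘(ℝ, E)) (fun y ↦ TotalSpace.mk' E y (X y)) x)
    (hY : MDifferentiableAt I (I.prod 𝓘(ℝ, E)) (fun y ↦ TotalSpace.mk' E y (Y y)) x) :
    MDifferentiableAt I 𝓘(ℝ) (pairing γ X Y) x := by
  have h : MDifferentiableAt I (I.prod 𝓘(ℝ))
      (fun m ↦ TotalSpace.mk' ℝ (E := Bundle.Trivial M ℝ) m (γ m (X m) (Y m))) x :=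
    MDifferentiableAt.clm_bundle_apply₂ (F₁ := E) (F₂ := E)
      (ContMDiff.mdifferentiableAt (n := ∞) hγ.smooth (by simp)) hX hY
  simp only [mdifferentiableAt_totalSpace] at h
  exact h.2

theorem IsBundleMetric.const_smul (hγ : IsBundleMetric I E γ) {c : ℝ} (hc : c ≠ 0) :
    IsBundleMetric I E (fun x ↦ c • γ x) where
  smooth := ContMDiff.const_smul_section (a := c) hγ.smooth
  symm x v w := by simp [hγ.symm x v w]
  nondegenerate x v h := hγ.nondegenerate x v fun w ↦ by
    simpa [hc] using h w

theorem isSmoothField_clm_apply {A : Π x : M, TangentSpace I x →L[ℝ] TangentSpace I x}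
    (hA : ContMDiff I (I.prod 𝓘(ℝ, E →L[ℝ] E)) ∞
      (fun x : M ↦ TotalSpace.mk' (E →L[ℝ] E)
        (E := fun x ↦ TangentSpace I x →L[ℝ] TangentSpace I x) x (A x)))
    {X : Π x : M, TangentSpace I x} (hX : IsSmoothField I X) :
    IsSmoothField I (fun x ↦ A x (X x)) :=
  ContMDiff.clm_bundle_apply (F₁ := E) (F₂ := E) hA hX

theorem contMDiff_id_hom : ContMDiff I (I.prod 𝓘(ℝ, E →L[ℝ] E)) ∞
    (fun x : M ↦ TotalSpace.mk' (E →L[ℝ] E)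
      (E := fun x ↦ TangentSpace I x →L[ℝ] TangentSpace I x) x
      (ContinuousLinearMap.id ℝ (TangentSpace I x))) := by
  intro x₀
  rw [contMDiffAt_hom_bundle]
  refine ⟨contMDiffAt_id, ?_⟩
  refine (contMDiffAt_const (c := ContinuousLinearMap.id ℝ E)).congr_of_eventuallyEq ?_
  have hb := (trivializationAt E (TangentSpace I) x₀).open_baseSet.mem_nhds
    (FiberBundle.mem_baseSet_trivializationAt' x₀)
  filter_upwards [hb] with x hx
  rw [ContinuousLinearMap.inCoordinates_eq hx hx]
  ext v
  simp

variable [FiniteDimensional ℝ E] [T2Space M]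

/-- Two tangent vectors are equal if they have the same pairings with all `C^∞` fields. -/
theorem eq_of_pairing_eq (hγ : IsBundleMetric I E γ) {x : M} {v w : TangentSpace I x}
    (h : ∀ Z : Π x : M, TangentSpace I x, IsSmoothField I Z → γ x v (Z x) = γ x w (Z x)) :
    v = w := by
  refine sub_eq_zero.1 (hγ.nondegenerate x _ fun u ↦ ?_)
  obtain ⟨Z, hZ, rfl⟩ := exists_isSmoothField_apply_eq x u
  simp [h Z hZ]

/-- A field whose pairings with all `C^∞` fields are `C^∞` is `C^∞`: in a local frame, its
coefficients are obtained from such pairings by inverting the Gram matrix of the frame. -/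
theorem isSmoothField_of_pairing (hγ : IsBundleMetric I E γ) {σ : Π x : M, TangentSpace I x}
    (h : ∀ Z : Π x : M, TangentSpace I x, IsSmoothField I Z →
      ContMDiff I 𝓘(ℝ) ∞ (pairing γ σ Z)) : IsSmoothField I σ := by
  intro x₀
  obtain ⟨n, Z, hZ, hfr⟩ := exists_frame (I := I) x₀
  -- `A x` is multiplication by the Gram matrix of the frame `Z` at `x`.
  let L : (Fin n → Fin n → ℝ) →L[ℝ] ((Fin n → ℝ) →L[ℝ] (Fin n → ℝ)) :=
    LinearMap.toContinuousLinearMap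
      { toFun := fun G ↦ LinearMap.toContinuousLinearMap (Matrix.toLin' (Matrix.of G))
        map_add' := fun G G' ↦ by ext; simp [← Matrix.of_add_of]
        map_smul' := fun c G ↦ by ext; simp [← Matrix.smul_of] }
  let A : M → ((Fin n → ℝ) →L[ℝ] (Fin n → ℝ)) := fun x ↦ L fun i j ↦ γ x (Z j x) (Z i x)
  have hA (x : M) (c : Fin n → ℝ) (i : Fin n) : A x c i = γ x (∑ j, c j • Z j x) (Z i x) := by
    simp [A, L, Matrix.mulVec, dotProduct, mul_comm]
  have hAsm : ContMDiff I 𝓘(ℝ, (Fin n → ℝ) →L[ℝ] (Fin n → ℝ)) ∞ A := by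
    refine L.contMDiff.comp ?_
    refine contMDiff_pi_space.2 fun i ↦ contMDiff_pi_space.2 fun j ↦ ?_
    exact contMDiff_pairing hγ (hZ j) (hZ i)
  have hinj : ∀ᶠ x in nhds x₀, Function.Injective (A x) := by
    filter_upwards [hfr] with x hx
    refine (injective_iff_map_eq_zero _).2 fun c hc ↦ ?_
    have h0 : ∑ j, c j • Z j x = 0 := by
      refine hγ.nondegenerate x _ fun w ↦ ?_
      obtain ⟨d, rfl⟩ := (Submodule.mem_span_range_iff_exists_fun ℝ).1 (hx.2 (x := w) trivial)
      rw [map_sum]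
      refine Finset.sum_eq_zero fun i _ ↦ ?_
      rw [map_smul, ← hA, hc]; simp
    exact funext (Fintype.linearIndependent_iff.1 hx.1 c h0)
  have hinv : ∀ᶠ x in nhds x₀, (A x).IsInvertible := by
    filter_upwards [hinj] with x hx
    exact ⟨(LinearEquiv.ofInjectiveEndo (A x : (Fin n → ℝ) →ₗ[ℝ] (Fin n → ℝ))
      hx).toContinuousLinearEquiv, by ext; rfl⟩
  let c : M → Fin n → ℝ := fun x ↦ (A x).inverse fun i ↦ γ x (σ x) (Z i x)
  have hc : ContMDiffAt I 𝓘(ℝ, Fin n → ℝ) ∞ c x₀ := by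
    refine ContMDiffAt.clm_apply ?_ ?_
    · exact hinv.self_of_nhds.contDiffAt_map_inverse.contMDiffAt.comp x₀ (hAsm x₀)
    · exact contMDiffAt_pi_space.2 fun i ↦ h (Z i) (hZ i) x₀
  have hσ : ∀ᶠ x in nhds x₀, σ x = ∑ i, c x i • Z i x := by
    filter_upwards [hinv, hfr] with x hx hx'
    refine sub_eq_zero.1 (hγ.nondegenerate x _ fun w ↦ ?_)
    obtain ⟨d, rfl⟩ := (Submodule.mem_span_range_iff_exists_fun ℝ).1 (hx'.2 (x := w) trivial)
    rw [map_sum]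
    refine Finset.sum_eq_zero fun i _ ↦ ?_
    rw [map_smul, map_sub, sub_apply, ← hA]
    have : A x (c x) = fun i ↦ γ x (σ x) (Z i x) := hx.self_apply_inverse _
    rw [this, sub_self, smul_zero]
  have hs : ContMDiffAt I (I.prod 𝓘(ℝ, E)) ∞
      (fun x ↦ TotalSpace.mk' E x (∑ i, c x i • Z i x)) x₀ :=
    ContMDiffAt.sum_section fun i _ ↦
      ContMDiffAt.smul_section (f := fun x ↦ c x i) (contMDiffAt_pi_space.1 hc i) (hZ i x₀)
  exact hs.congr_of_eventuallyEq (hσ.mono fun x hx ↦ by simp only [hx])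

end Metric

/-! ### Lie derivatives of forms and para-Hermitian structures -/

section LieDerivative

variable {E : Type*} [NormedAddCommGroup E] [NormedSpace ℝ E] [FiniteDimensional ℝ E]
  {H : Type*} [TopologicalSpace H] {I : ModelWithCorners ℝ E H}
  {M : Type*} [TopologicalSpace M] [ChartedSpace H M] [IsManifold I ∞ M]

/-- The defining formula of `𝔏_X α`, valid as soon as `α` pairs differentiable fields to
differentiable functions: the defining expression is then tensorial, so that the junk value of
`lieDerivForm` does not occur. -/
theorem lieDerivForm_apply (X : Π x : M, TangentSpace I x)
    {α : Π x : M, TangentSpace I x →L[ℝ] ℝ} {x : M}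
    (hα : ∀ Z : Π x : M, TangentSpace I x,
      MDifferentiableAt I (I.prod 𝓘(ℝ, E)) (fun y ↦ TotalSpace.mk' E y (Z y)) x →
        MDifferentiableAt I 𝓘(ℝ) (fun y ↦ α y (Z y)) x)
    {Z : Π x : M, TangentSpace I x} (hZ : IsSmoothField I Z) :
    lieDerivForm I X α x (Z x) =
      dirDeriv I X (fun y ↦ α y (Z y)) x - α x (VectorField.mlieBracket I X Z x) := by
  have : CompleteSpace E := FiniteDimensional.complete ℝ E
  have : IsManifold I (1 + 1) M := IsManifold.of_le (n := ∞) (by norm_cast)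
  have ht : TensorialAt I E (fun Z : Π x : M, TangentSpace I x ↦
      mvfderiv I (fun y ↦ α y (Z y)) x (X x) - α x (VectorField.mlieBracket I X Z x)) x := by
    constructor
    · intro f σ hf hσ
      have h1 : (fun y ↦ α y ((f • σ) y)) = f * fun y ↦ α y (σ y) := by
        ext y; simp
      have h2 := dirDeriv_mul X hf (hα σ hσ)
      rw [VectorField.mlieBracket_smul_right hf hσ, h1]
      simp only [dirDeriv] at h2
      rw [h2]
      simp only [map_add, map_smul, smul_eq_mul]
      ring
    · intro σ σ' hσ hσ'
      have h1 : (fun y ↦ α y ((σ + σ') y)) = (fun y ↦ α y (σ y)) + fun y ↦ α y (σ' y) := by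
        ext y; simp
      have h2 := dirDeriv_add X (hα σ hσ) (hα σ' hσ')
      rw [VectorField.mlieBracket_add_right hσ hσ', h1]
      simp only [dirDeriv] at h2
      rw [h2, map_add]
      ring
  rw [lieDerivForm, dif_pos ht]
  exact TensorialAt.mkHom_apply ht (hZ.mdiffAt x)

end LieDerivative

section ParaHermitian

variable {E : Type*} [NormedAddCommGroup E] [NormedSpace ℝ E]
  {H : Type*} [TopologicalSpace H] {I : ModelWithCorners ℝ E H}
  {M : Type*} [TopologicalSpace M] [ChartedSpace H M]
  {γ : Π x : M, TangentSpace I x →L[ℝ] TangentSpace I x →L[ℝ] ℝ}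
  {F : Π x : M, TangentSpace I x →L[ℝ] TangentSpace I x}

theorem mem_eigenFibre {c : ℝ} {x : M} {v : TangentSpace I x} :
    v ∈ eigenFibre F c x ↔ F x v = c • v :=
  Module.End.mem_eigenspace_iff

theorem eigenFibre_neg (c : ℝ) (x : M) :
    eigenFibre (fun x ↦ -F x) c x = eigenFibre F (-c) x := by
  ext v
  rw [mem_eigenFibre, mem_eigenFibre, neg_smul, neg_apply, neg_eq_iff_eq_neg]

theorem fundamentalForm_neg :
    fundamentalForm γ (fun x ↦ -F x) = fun x ↦ -fundamentalForm γ F x := by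
  ext x v w
  simp [fundamentalForm]

theorem prL_neg : prL (fun x ↦ -F x) = prLbar F := by
  ext x v
  simp [prL, prLbar, sub_eq_add_neg]

theorem prLbar_neg : prLbar (fun x ↦ -F x) = prL F := by
  ext x v
  simp [prL, prLbar]

variable (F) in
/-- The `L`-component `X_L` of a field. -/
def fieldL (X : Π x : M, TangentSpace I x) (x : M) : TangentSpace I x :=
  prL F x (X x)

theorem fieldL_add (X Y : Π x : M, TangentSpace I x) :
    fieldL F (X + Y) = fieldL F X + fieldL F Y := by
  ext x; simp [fieldL]

theorem fieldL_smul (c : ℝ) (X : Π x : M, TangentSpace I x) :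
    fieldL F (c • X) = c • fieldL F X := by
  ext x; simp [fieldL]

theorem prL_apply (x : M) (v : TangentSpace I x) : prL F x v = (1 / 2 : ℝ) • (v + F x v) := rfl

theorem prLbar_apply (x : M) (v : TangentSpace I x) :
    prLbar F x v = (1 / 2 : ℝ) • (v - F x v) := rfl

theorem prL_add_prLbar (x : M) (v : TangentSpace I x) : prL F x v + prLbar F x v = v := by
  rw [prL_apply, prLbar_apply]; module

theorem fundamentalForm_apply (x : M) (v w : TangentSpace I x) :
    fundamentalForm γ F x v w = γ x v (F x w) := rfl

theorem prL_eq_self {x : M} {v : TangentSpace I x} (hv : F x v = v) : prL F x v = v := by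
  rw [prL_apply, hv]; module

theorem prLbar_eq_zero {x : M} {v : TangentSpace I x} (hv : F x v = v) : prLbar F x v = 0 := by
  rw [prLbar_apply, hv]; simp

section Manifold

variable [IsManifold I ∞ M]

namespace IsParaHermitian

variable (h : IsParaHermitian I γ F)
include h

theorem F_prL (x : M) (v : TangentSpace I x) : F x (prL F x v) = prL F x v := by
  rw [prL_apply, map_smul, map_add, h.F_sq, add_comm]

theorem prL_F (x : M) (v : TangentSpace I x) : prL F x (F x v) = prL F x v := by
  rw [prL_apply, prL_apply, h.F_sq, add_comm]

theorem prL_prL (x : M) (v : TangentSpace I x) : prL F x (prL F x v) = prL F x v :=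
  prL_eq_self (h.F_prL x v)

theorem prL_prLbar (x : M) (v : TangentSpace I x) : prL F x (prLbar F x v) = 0 := by
  have := congrArg (prL F x) (prL_add_prLbar (F := F) x v)
  rwa [map_add, h.prL_prL, add_eq_left] at this

/-- The two projections are adjoint for the metric, because `F` is skew. -/
theorem metric_prL_left (x : M) (v w : TangentSpace I x) :
    γ x (prL F x v) w = γ x v (prLbar F x w) := by
  simp only [prL_apply, prLbar_apply, map_smul, map_add, map_sub, smul_apply, add_apply,
    h.F_skew, smul_eq_mul]
  ring

theorem metric_prLbar_left (x : M) (v w : TangentSpace I x) :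
    γ x (prLbar F x v) w = γ x v (prL F x w) := by
  simp only [prL_apply, prLbar_apply, map_smul, map_add, map_sub, smul_apply, sub_apply,
    h.F_skew, smul_eq_mul]
  ring

theorem metric_eq (x : M) (v w : TangentSpace I x) :
    γ x v w = γ x (prL F x v) w + γ x v (prL F x w) := by
  rw [h.metric_prL_left, ← map_add, add_comm, prL_add_prLbar]

/-- `L` is isotropic. -/
theorem metric_eq_zero {x : M} {v w : TangentSpace I x} (hv : F x v = v) (hw : F x w = w) :
    γ x v w = 0 := by
  rw [← prL_eq_self hv, h.metric_prL_left, prLbar_eq_zero hw, map_zero]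

theorem fundamentalForm_nondegenerate (x : M) (v : TangentSpace I x)
    (hv : ∀ w, fundamentalForm γ F x v w = 0) : v = 0 :=
  h.metric.nondegenerate x v fun w ↦ by
    rw [← h.F_sq x w]; exact hv (F x w)

theorem pairing_eq (σ Z : Π x : M, TangentSpace I x) :
    pairing γ σ Z = pairing γ (fieldL F σ) Z + pairing γ σ (fieldL F Z) := by
  ext x; exact h.metric_eq x (σ x) (Z x)

/-- Exchanging the two foliations gives a para-Hermitian structure again. -/
theorem neg : IsParaHermitian I γ (fun x ↦ -F x) where
  metric := h.metric
  F_smooth := ContMDiff.neg_section h.F_smooth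
  F_sq x v := by simp [h.F_sq x v]
  equal_rank x := by
    rw [eigenFibre_neg, eigenFibre_neg, neg_neg, h.equal_rank x]
  F_skew x v w := by simp [h.F_skew x v w]
  integrable_pos X Y hX hY hXL hYL x := by
    simp only [eigenFibre_neg] at hXL hYL ⊢
    exact h.integrable_neg X Y hX hY hXL hYL x
  integrable_neg X Y hX hY hXL hYL x := by
    simp only [eigenFibre_neg, neg_neg] at hXL hYL ⊢
    exact h.integrable_pos X Y hX hY hXL hYL x

theorem contMDiff_prL : ContMDiff I (I.prod 𝓘(ℝ, E →L[ℝ] E)) ∞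
    (fun x : M ↦ TotalSpace.mk' (E →L[ℝ] E)
      (E := fun x ↦ TangentSpace I x →L[ℝ] TangentSpace I x) x (prL F x)) :=
  ContMDiff.const_smul_section (a := (1 / 2 : ℝ))
    (ContMDiff.add_section contMDiff_id_hom h.F_smooth)

/-- The fundamental form and the metric agree on `L̄ × L`. -/
theorem fundamentalForm_prLbar {x : M} (v : TangentSpace I x) {w : TangentSpace I x}
    (hw : F x w = w) : fundamentalForm γ F x (prLbar F x v) w = γ x v w := by
  rw [fundamentalForm_apply, hw, h.metric_prLbar_left, prL_eq_self hw]

theorem isSmoothField_fieldL {X : Π x : M, TangentSpace I x} (hX : IsSmoothField I X) :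
    IsSmoothField I (fieldL F X) :=
  isSmoothField_clm_apply h.contMDiff_prL hX

theorem F_fieldL (X : Π x : M, TangentSpace I x) (x : M) :
    F x (fieldL F X x) = fieldL F X x :=
  h.F_prL x (X x)

theorem F_mlieBracket {X Y : Π x : M, TangentSpace I x} (hX : IsSmoothField I X)
    (hY : IsSmoothField I Y) (hXL : ∀ x, F x (X x) = X x) (hYL : ∀ x, F x (Y x) = Y x) (x : M) :
    F x (VectorField.mlieBracket I X Y x) = VectorField.mlieBracket I X Y x := by
  have := h.integrable_pos X Y hX hY (fun x ↦ by rw [mem_eigenFibre, hXL, one_smul])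
    (fun x ↦ by rw [mem_eigenFibre, hYL, one_smul]) x
  rwa [mem_eigenFibre, one_smul] at this

theorem exists_metric_ne_zero (x : M) (hE : 0 < Module.finrank ℝ E) :
    ∃ v w : TangentSpace I x, γ x (prL F x v) (prLbar F x w) ≠ 0 := by
  by_contra! hne
  have : Nontrivial E := Module.nontrivial_of_finrank_pos hE
  obtain ⟨v, hv⟩ : ∃ v : TangentSpace I x, v ≠ 0 := exists_ne (α := E) 0
  have h0 (v w : TangentSpace I x) : γ x (prL F x v) w = 0 := by
    rw [← h.prL_prL, h.metric_prL_left]; exact hne v w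
  refine hv (h.metric.nondegenerate x v fun w ↦ ?_)
  rw [h.metric_eq, h0, h.metric.symm, h0, add_zero]

end IsParaHermitian

variable [FiniteDimensional ℝ E]

/-- Exchanging `L` and `L̄` amounts to replacing `F` by `-F`. -/
theorem dorfmanL_neg : dorfmanL I γ (fun x ↦ -F x) = dorfmanLbar I γ F := by
  ext X Y x
  rw [dorfmanL, dorfmanLbar, fundamentalForm_neg, prL_neg, prLbar_neg]

namespace IsParaHermitian

variable (h : IsParaHermitian I γ F)
include h

theorem metric_sharp_comp_prL (x : M) (α : TangentSpace I x →L[ℝ] ℝ) (w : TangentSpace I x) :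
    γ x (sharp (fundamentalForm γ F) x (α.comp (prL F x))) w = α (prL F x w) := by
  have h1 := apply_sharp (h.fundamentalForm_nondegenerate x) (α.comp (prL F x))
  have h2 := congrArg (fun β ↦ β (F x w)) h1
  simpa [fundamentalForm_apply, h.F_sq, h.prL_F] using h2

theorem prL_sharp_comp_prL (x : M) (α : TangentSpace I x →L[ℝ] ℝ) :
    prL F x (sharp (fundamentalForm γ F) x (α.comp (prL F x))) = 0 :=
  h.metric.nondegenerate x _ fun w ↦ by
    rw [h.metric_prL_left, h.metric_sharp_comp_prL, h.prL_prLbar, map_zero]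

theorem fieldL_dorfmanL {X Y : Π x : M, TangentSpace I x} (hX : IsSmoothField I X)
    (hY : IsSmoothField I Y) :
    fieldL F (dorfmanL I γ F X Y) = VectorField.mlieBracket I (fieldL F X) (fieldL F Y) := by
  ext x
  have hb := h.F_mlieBracket (h.isSmoothField_fieldL hX) (h.isSmoothField_fieldL hY)
    (h.F_fieldL X) (h.F_fieldL Y) x
  change prL F x (VectorField.mlieBracket I (fieldL F X) (fieldL F Y) x + _) = _
  rw [map_add, h.prL_sharp_comp_prL, add_zero, prL_eq_self hb]

/-- On sections of `L`, the form `𝔏_X i(Y_L̄)ω` is expressed by the metric alone. -/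
theorem lieDerivForm_fundamentalForm {X Y W : Π x : M, TangentSpace I x}
    (hX : IsSmoothField I X) (hXL : ∀ x, F x (X x) = X x) (hY : IsSmoothField I Y)
    (hW : IsSmoothField I W) (hWL : ∀ x, F x (W x) = W x) (x : M) :
    lieDerivForm I X (fun y ↦ fundamentalForm γ F y (prLbar F y (Y y))) x (W x) =
      dirDeriv I X (pairing γ Y W) x - pairing γ Y (VectorField.mlieBracket I X W) x := by
  rw [lieDerivForm_apply X _ hW,
    h.fundamentalForm_prLbar (Y x) (h.F_mlieBracket hX hW hXL hWL x)]
  · have : (fun y ↦ fundamentalForm γ F y (prLbar F y (Y y)) (W y)) = pairing γ Y W := by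
      ext y; exact h.fundamentalForm_prLbar (Y y) (hWL y)
    rw [this]; rfl
  · intro Z hZ
    have hQ : IsSmoothField I fun y ↦ prLbar F y (Y y) := by
      rw [← prL_neg]; exact h.neg.isSmoothField_fieldL hY
    exact mdifferentiableAt_pairing h.metric (hQ.mdiffAt x)
      (MDifferentiableAt.clm_bundle_apply (F₁ := E) (F₂ := E)
        (ContMDiff.mdifferentiableAt (n := ∞) h.F_smooth (by simp)) hZ)

/-- The Dorfman product of `L` is determined by its `L`-component `[X_L, Y_L]` and by its pairings
with the sections of `L`. -/
theorem pairing_dorfmanL {X Y W : Π x : M, TangentSpace I x}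
    (hX : IsSmoothField I X) (hY : IsSmoothField I Y)
    (hW : IsSmoothField I W) (hWL : ∀ x, F x (W x) = W x) :
    pairing γ (dorfmanL I γ F X Y) W =
      dirDeriv I (fieldL F X) (pairing γ Y W)
      - pairing γ Y (VectorField.mlieBracket I (fieldL F X) W)
      - dirDeriv I (fieldL F Y) (pairing γ X W)
      + pairing γ X (VectorField.mlieBracket I (fieldL F Y) W)
      + dirDeriv I W (pairing γ X (fieldL F Y)) := by
  ext x
  have hX' := h.isSmoothField_fieldL hX
  have hY' := h.isSmoothField_fieldL hY
  have hb := h.F_mlieBracket hX' hY' (h.F_fieldL X) (h.F_fieldL Y) x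
  have hd : (fun y ↦ fundamentalForm γ F y (prLbar F y (X y)) (fieldL F Y y)) =
      pairing γ X (fieldL F Y) := by
    ext y; exact h.fundamentalForm_prLbar (X y) (h.F_fieldL Y y)
  change γ x (VectorField.mlieBracket I (fieldL F X) (fieldL F Y) x
    + sharp (fundamentalForm γ F) x (ContinuousLinearMap.comp
      (lieDerivForm I (fieldL F X) (fun y ↦ fundamentalForm γ F y (prLbar F y (Y y))) x
      - lieDerivForm I (fieldL F Y) (fun y ↦ fundamentalForm γ F y (prLbar F y (X y))) x
      + mvfderiv I (fun y ↦ fundamentalForm γ F y (prLbar F y (X y)) (fieldL F Y y)) x)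
        (prL F x))) (W x) = _
  rw [map_add, add_apply, h.metric_eq_zero hb (hWL x), h.metric_sharp_comp_prL,
    prL_eq_self (hWL x), add_apply, sub_apply,
    h.lieDerivForm_fundamentalForm hX' (h.F_fieldL X) hY hW hWL,
    h.lieDerivForm_fundamentalForm hY' (h.F_fieldL Y) hX hW hWL, hd]
  simp only [Pi.add_apply, Pi.sub_apply, dirDeriv]
  ring

/-- Invariance of the metric under the Dorfman product. -/
theorem dirDeriv_pairing {X Y Z : Π x : M, TangentSpace I x} (hX : IsSmoothField I X)
    (hY : IsSmoothField I Y) (hZ : IsSmoothField I Z) :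
    dirDeriv I (fieldL F X) (pairing γ Y Z) =
      pairing γ (dorfmanL I γ F X Y) Z + pairing γ Y (dorfmanL I γ F X Z) := by
  have hX' := h.isSmoothField_fieldL hX
  have hY' := h.isSmoothField_fieldL hY
  have hZ' := h.isSmoothField_fieldL hZ
  have hsymm (A B : Π x : M, TangentSpace I x) : pairing γ A B = pairing γ B A := by
    ext x; exact h.metric.symm x _ _
  rw [hsymm Y (dorfmanL I γ F X Z), h.pairing_eq (dorfmanL I γ F X Y) Z,
    h.pairing_eq (dorfmanL I γ F X Z) Y, h.fieldL_dorfmanL hX hY, h.fieldL_dorfmanL hX hZ,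
    h.pairing_dorfmanL hX hY hZ' (h.F_fieldL Z), h.pairing_dorfmanL hX hZ hY' (h.F_fieldL Y),
    h.pairing_eq Y Z, hsymm (fieldL F Y) Z, hsymm _ Z, hsymm _ Y,
    VectorField.mlieBracket_swap (V := fieldL F Z) (W := fieldL F Y)]
  ext x
  rw [dirDeriv_add _ ((contMDiff_pairing h.metric hZ hY').mdiffAt x)
    ((contMDiff_pairing h.metric hY hZ').mdiffAt x)]
  simp only [Pi.add_apply, Pi.sub_apply, pairing, Pi.neg_apply, map_neg]
  ring

end IsParaHermitian

end Manifold

end ParaHermitian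

/-! ### The Dorfman products of the two foliations -/

section Dorfman

variable {E : Type*} [NormedAddCommGroup E] [NormedSpace ℝ E] [FiniteDimensional ℝ E]
  {H : Type*} [TopologicalSpace H] {I : ModelWithCorners ℝ E H}
  {M : Type*} [TopologicalSpace M] [T2Space M] [ChartedSpace H M] [IsManifold I ∞ M]
  {γ : Π x : M, TangentSpace I x →L[ℝ] TangentSpace I x →L[ℝ] ℝ}
  {F : Π x : M, TangentSpace I x →L[ℝ] TangentSpace I x}

namespace IsParaHermitian

variable (h : IsParaHermitian I γ F)
include h

/-- A field is determined by its `L`-component and its pairings with the sections of `L`. -/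
theorem field_ext {σ τ : Π x : M, TangentSpace I x} (hL : fieldL F σ = fieldL F τ)
    (hp : ∀ W : Π x : M, TangentSpace I x, IsSmoothField I W → (∀ x, F x (W x) = W x) →
      pairing γ σ W = pairing γ τ W) : σ = τ := by
  ext x
  refine eq_of_pairing_eq h.metric fun Z hZ ↦ ?_
  have := h.pairing_eq σ Z
  rw [hL, hp _ (h.isSmoothField_fieldL hZ) (h.F_fieldL Z), ← h.pairing_eq τ Z] at this
  exact congrFun this x

theorem isSmoothField_dorfmanL {X Y : Π x : M, TangentSpace I x} (hX : IsSmoothField I X)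
    (hY : IsSmoothField I Y) : IsSmoothField I (dorfmanL I γ F X Y) := by
  refine isSmoothField_of_pairing h.metric fun Z hZ ↦ ?_
  have hX' := h.isSmoothField_fieldL hX
  have hY' := h.isSmoothField_fieldL hY
  have hW := h.isSmoothField_fieldL hZ
  rw [h.pairing_eq, h.fieldL_dorfmanL hX hY, h.pairing_dorfmanL hX hY hW (h.F_fieldL Z)]
  exact (contMDiff_pairing h.metric (isSmoothField_mlieBracket hX' hY') hZ).add
    (contMDiff_sub_sub_add_add
      (contMDiff_dirDeriv hX' (contMDiff_pairing h.metric hY hW))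
      (contMDiff_pairing h.metric hY (isSmoothField_mlieBracket hX' hW))
      (contMDiff_dirDeriv hY' (contMDiff_pairing h.metric hX hW))
      (contMDiff_pairing h.metric hX (isSmoothField_mlieBracket hY' hW))
      (contMDiff_dirDeriv hW (contMDiff_pairing h.metric hX hY')))

/-- Normalization of the Dorfman product. -/
theorem metric_dorfmanL_self {X : Π x : M, TangentSpace I x} (hX : IsSmoothField I X) (x : M)
    (w : TangentSpace I x) :
    γ x (dorfmanL I γ F X X x) w = 1 / 2 * mvfderiv I (pairing γ X X) x (prL F x w) := by
  obtain ⟨Z, hZ, rfl⟩ := exists_isSmoothField_apply_eq x w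
  have hW := h.isSmoothField_fieldL hZ
  have h1 : pairing γ X X = fun x ↦ 2 * pairing γ X (fieldL F X) x := by
    ext x
    rw [h.pairing_eq X X]
    simp only [Pi.add_apply, pairing, h.metric.symm x (fieldL F X x)]
    ring
  have h2 : pairing γ (dorfmanL I γ F X X) Z =
      dirDeriv I (fieldL F Z) (pairing γ X (fieldL F X)) := by
    rw [h.pairing_eq, h.fieldL_dorfmanL hX hX, h.pairing_dorfmanL hX hX hW (h.F_fieldL Z),
      VectorField.mlieBracket_self]
    ext x
    simp only [Pi.add_apply, Pi.sub_apply, pairing, Pi.zero_apply, map_zero, zero_apply]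
    ring
  have h3 := congrFun h2 x
  have h4 := dirDeriv_const_mul (fieldL F Z) 2
    ((contMDiff_pairing h.metric hX (h.isSmoothField_fieldL hX)).mdiffAt x)
  rw [← h1] at h4
  change pairing γ (dorfmanL I γ F X X) Z x = 1 / 2 * dirDeriv I (fieldL F Z) (pairing γ X X) x
  rw [h3, h4]
  ring

theorem dorfmanL_add_left {X X' Y : Π x : M, TangentSpace I x} (hX : IsSmoothField I X)
    (hX' : IsSmoothField I X') (hY : IsSmoothField I Y) :
    dorfmanL I γ F (X + X') Y = dorfmanL I γ F X Y + dorfmanL I γ F X' Y := by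
  have : CompleteSpace E := FiniteDimensional.complete ℝ E
  have hXX' := isSmoothField_add hX hX'
  have hbr {A B C : Π x : M, TangentSpace I x} (hA : IsSmoothField I A) (hB : IsSmoothField I B) :
      VectorField.mlieBracket I (A + B) C =
        VectorField.mlieBracket I A C + VectorField.mlieBracket I B C := by
    ext x; exact VectorField.mlieBracket_add_left (hA.mdiffAt x) (hB.mdiffAt x)
  have hl := hbr (C := fieldL F Y) (h.isSmoothField_fieldL hX) (h.isSmoothField_fieldL hX')
  refine h.field_ext ?_ fun W hW hWL ↦ ?_
  · rw [fieldL_add, h.fieldL_dorfmanL hXX' hY, h.fieldL_dorfmanL hX hY, h.fieldL_dorfmanL hX' hY,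
      fieldL_add, hl]
  · rw [pairing_add_left, h.pairing_dorfmanL hXX' hY hW hWL, h.pairing_dorfmanL hX hY hW hWL,
      h.pairing_dorfmanL hX' hY hW hWL, fieldL_add,
      hbr (h.isSmoothField_fieldL hX) (h.isSmoothField_fieldL hX'), pairing_add_right,
      pairing_add_left, pairing_add_left, pairing_add_left]
    ext x
    simp only [Pi.add_apply, Pi.sub_apply]
    rw [dirDeriv_add_field, dirDeriv_add _ ((contMDiff_pairing h.metric hX hW).mdiffAt x)
      ((contMDiff_pairing h.metric hX' hW).mdiffAt x),
      dirDeriv_add _ ((contMDiff_pairing h.metric hX (h.isSmoothField_fieldL hY)).mdiffAt x)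
      ((contMDiff_pairing h.metric hX' (h.isSmoothField_fieldL hY)).mdiffAt x)]
    ring

theorem dorfmanL_smul_left (c : ℝ) {X Y : Π x : M, TangentSpace I x} (hX : IsSmoothField I X)
    (hY : IsSmoothField I Y) : dorfmanL I γ F (c • X) Y = c • dorfmanL I γ F X Y := by
  have : CompleteSpace E := FiniteDimensional.complete ℝ E
  have hcX := isSmoothField_const_smul c hX
  have hbr {A C : Π x : M, TangentSpace I x} (hA : IsSmoothField I A) :
      VectorField.mlieBracket I (c • A) C = c • VectorField.mlieBracket I A C := by
    ext x; exact VectorField.mlieBracket_const_smul_left (hA.mdiffAt x)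
  refine h.field_ext ?_ fun W hW hWL ↦ ?_
  · rw [fieldL_smul, h.fieldL_dorfmanL hcX hY, h.fieldL_dorfmanL hX hY, fieldL_smul,
      hbr (h.isSmoothField_fieldL hX)]
  · rw [pairing_smul_left, h.pairing_dorfmanL hcX hY hW hWL, h.pairing_dorfmanL hX hY hW hWL,
      fieldL_smul, hbr (h.isSmoothField_fieldL hX), pairing_smul_right,
      pairing_smul_left, pairing_smul_left, pairing_smul_left]
    ext x
    simp only [Pi.add_apply, Pi.sub_apply]
    rw [dirDeriv_smul_field, dirDeriv_const_mul _ _ ((contMDiff_pairing h.metric hX hW).mdiffAt x),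
      dirDeriv_const_mul _ _
        ((contMDiff_pairing h.metric hX (h.isSmoothField_fieldL hY)).mdiffAt x)]
    ring

/-- By the invariance of the metric, additivity in the right factor follows from that of
`γ(Y, Z)` in `Y`. -/
theorem dorfmanL_add_right {X Y Y' : Π x : M, TangentSpace I x} (hX : IsSmoothField I X)
    (hY : IsSmoothField I Y) (hY' : IsSmoothField I Y') :
    dorfmanL I γ F X (Y + Y') = dorfmanL I γ F X Y + dorfmanL I γ F X Y' := by
  ext x
  refine eq_of_pairing_eq h.metric fun Z hZ ↦ ?_
  have h1 := congrFun (h.dirDeriv_pairing hX hY hZ) x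
  have h2 := congrFun (h.dirDeriv_pairing hX hY' hZ) x
  have h3 := congrFun (h.dirDeriv_pairing hX (isSmoothField_add hY hY') hZ) x
  rw [pairing_add_left, pairing_add_left, dirDeriv_add _
    ((contMDiff_pairing h.metric hY hZ).mdiffAt x)
    ((contMDiff_pairing h.metric hY' hZ).mdiffAt x), h1, h2] at h3
  simp only [Pi.add_apply, pairing, map_add, add_apply] at h3 ⊢
  linarith

theorem dorfmanL_smul_right (c : ℝ) {X Y : Π x : M, TangentSpace I x} (hX : IsSmoothField I X)
    (hY : IsSmoothField I Y) : dorfmanL I γ F X (c • Y) = c • dorfmanL I γ F X Y := by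
  ext x
  refine eq_of_pairing_eq h.metric fun Z hZ ↦ ?_
  have h1 := congrFun (h.dirDeriv_pairing hX hY hZ) x
  have h2 := congrFun (h.dirDeriv_pairing hX (isSmoothField_const_smul c hY) hZ) x
  rw [pairing_smul_left, pairing_smul_left, dirDeriv_const_mul _ _
    ((contMDiff_pairing h.metric hY hZ).mdiffAt x), h1] at h2
  simp only [Pi.add_apply, Pi.smul_apply, pairing, map_smul, smul_apply, smul_eq_mul] at h2 ⊢
  linarith

/-- The `L`-components of the Leibniz identity satisfy the Jacobi identity. Paired with a section
`W` of `L`, its two sides become sums of iterated derivatives and of pairings with iterated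
brackets, which agree by the commutator formula and the Jacobi identity in `L`. -/
theorem dorfmanL_leibniz {X Y Z : Π x : M, TangentSpace I x} (hX : IsSmoothField I X)
    (hY : IsSmoothField I Y) (hZ : IsSmoothField I Z) :
    dorfmanL I γ F X (dorfmanL I γ F Y Z) =
      dorfmanL I γ F (dorfmanL I γ F X Y) Z + dorfmanL I γ F Y (dorfmanL I γ F X Z) := by
  have hYZ := h.isSmoothField_dorfmanL hY hZ
  have hXY := h.isSmoothField_dorfmanL hX hY
  have hXZ := h.isSmoothField_dorfmanL hX hZ
  have sX := h.isSmoothField_fieldL hX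
  have sY := h.isSmoothField_fieldL hY
  have sZ := h.isSmoothField_fieldL hZ
  have lX := h.F_fieldL X
  have lY := h.F_fieldL Y
  have lZ := h.F_fieldL Z
  have eYZ := h.fieldL_dorfmanL hY hZ
  have eXY := h.fieldL_dorfmanL hX hY
  have eXZ := h.fieldL_dorfmanL hX hZ
  refine h.field_ext ?_ fun W hW hWL ↦ ?_
  · rw [fieldL_add, h.fieldL_dorfmanL hX hYZ, h.fieldL_dorfmanL hXY hZ, h.fieldL_dorfmanL hY hXZ,
      eYZ, eXY, eXZ]
    ext x
    exact mlieBracket_jacobi sX sY sZ x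
  · have sXW := isSmoothField_mlieBracket sX hW
    have sYW := isSmoothField_mlieBracket sY hW
    have sZW := isSmoothField_mlieBracket sZ hW
    have lXW := h.F_mlieBracket sX hW lX hWL
    have lYW := h.F_mlieBracket sY hW lY hWL
    have lZW := h.F_mlieBracket sZ hW lZ hWL
    have expand {U : Π x : M, TangentSpace I x} (x : M) {A B V : Π x : M, TangentSpace I x}
        (hA : IsSmoothField I A) (hB : IsSmoothField I B)
        (hV : IsSmoothField I V) (hVL : ∀ x, F x (V x) = V x) :
        dirDeriv I U (pairing γ (dorfmanL I γ F A B) V) x =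
          dirDeriv I U (dirDeriv I (fieldL F A) (pairing γ B V)) x
          - dirDeriv I U (pairing γ B (VectorField.mlieBracket I (fieldL F A) V)) x
          - dirDeriv I U (dirDeriv I (fieldL F B) (pairing γ A V)) x
          + dirDeriv I U (pairing γ A (VectorField.mlieBracket I (fieldL F B) V)) x
          + dirDeriv I U (dirDeriv I V (pairing γ A (fieldL F B))) x := by
      have sA := h.isSmoothField_fieldL hA
      have sB := h.isSmoothField_fieldL hB
      rw [h.pairing_dorfmanL hA hB hV hVL]
      exact dirDeriv_sub_sub_add_add U
        (contMDiff_dirDeriv sA (contMDiff_pairing h.metric hB hV))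
        (contMDiff_pairing h.metric hB (isSmoothField_mlieBracket sA hV))
        (contMDiff_dirDeriv sB (contMDiff_pairing h.metric hA hV))
        (contMDiff_pairing h.metric hA (isSmoothField_mlieBracket sB hV))
        (contMDiff_dirDeriv hV (contMDiff_pairing h.metric hA sB)) x
    ext x
    have C (A B : Π x : M, TangentSpace I x) {U V : Π x : M, TangentSpace I x}
        (hU : IsSmoothField I U) (hV : IsSmoothField I V)
        (hA : IsSmoothField I A) (hB : IsSmoothField I B) :=
      dirDeriv_mlieBracket hU hV (contMDiff_pairing h.metric hA hB) x
    have J (A : Π x : M, TangentSpace I x) {U V : Π x : M, TangentSpace I x}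
        (hU : IsSmoothField I U) (hV : IsSmoothField I V) :
        pairing γ A (VectorField.mlieBracket I U (VectorField.mlieBracket I V W)) x =
          pairing γ A (VectorField.mlieBracket I (VectorField.mlieBracket I U V) W) x
          + pairing γ A (VectorField.mlieBracket I V (VectorField.mlieBracket I U W)) x := by
      simp only [pairing]
      rw [mlieBracket_jacobi hU hV hW, map_add]
    rw [pairing_add_left, h.pairing_dorfmanL hX hYZ hW hWL, h.pairing_dorfmanL hXY hZ hW hWL,
      h.pairing_dorfmanL hY hXZ hW hWL, eYZ, eXY, eXZ]
    simp only [Pi.add_apply, Pi.sub_apply]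
    rw [expand x hY hZ hW hWL, h.pairing_dorfmanL hY hZ sXW lXW, expand x hX hY hW hWL,
      h.pairing_dorfmanL hX hY sZW lZW, expand x hX hY sZ lZ, expand x hX hZ hW hWL,
      h.pairing_dorfmanL hX hZ sYW lYW]
    simp only [Pi.add_apply, Pi.sub_apply]
    -- Iterated derivatives of a pairing are commuted by `C`, and iterated brackets with `W` are
    -- rearranged by the Jacobi identity `J`.
    linear_combination C Y W sX sZ hY hW - C Z W sX sY hZ hW - C X W sY sZ hX hW
      - C Y (fieldL F Z) sX hW hY sZ + C X (fieldL F Z) sY hW hX sZ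
      - C X (fieldL F Y) sZ hW hX sY - J Z sX sY + J Y sX sZ - J X sY sZ

end IsParaHermitian

end Dorfman

/-! ### The algebroids, and the failure of the Leibniz identity -/

section Algebroids

variable {E : Type*} [NormedAddCommGroup E] [NormedSpace ℝ E] [FiniteDimensional ℝ E]
  {H : Type*} [TopologicalSpace H] {I : ModelWithCorners ℝ E H}
  {M : Type*} [TopologicalSpace M] [T2Space M] [ChartedSpace H M] [IsManifold I ∞ M]
  {γ : Π x : M, TangentSpace I x →L[ℝ] TangentSpace I x →L[ℝ] ℝ}
  {F : Π x : M, TangentSpace I x →L[ℝ] TangentSpace I x}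

namespace IsParaHermitian

variable (h : IsParaHermitian I γ F)
include h

theorem isMetricAlgebroid_dorfmanL :
    IsMetricAlgebroid I E (fun x ↦ (1 / 2 : ℝ) • γ x) (prL F) (dorfmanL I γ F) where
  metric := h.metric.const_smul (by norm_num)
  anchor_smooth := h.contMDiff_prL
  star_smooth _ _ hX hY := h.isSmoothField_dorfmanL hX hY
  star_add_left _ _ _ hX hX' hY := h.dorfmanL_add_left hX hX' hY
  star_add_right _ _ _ hX hY hY' := h.dorfmanL_add_right hX hY hY'
  star_smul_left c _ _ hX hY := h.dorfmanL_smul_left c hX hY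
  star_smul_right c _ _ hX hY := h.dorfmanL_smul_right c hX hY
  compatible X Y Z hX hY hZ x := by
    have h1 := dirDeriv_const_mul (fieldL F X) (1 / 2)
      ((contMDiff_pairing h.metric hY hZ).mdiffAt x)
    rw [h.dirDeriv_pairing hX hY hZ] at h1
    refine h1.trans ?_
    simp only [Pi.add_apply, pairing, smul_apply, smul_eq_mul]
    ring
  normalized X hX x := by
    have hγ := h.metric.const_smul (c := 1 / 2) (by norm_num)
    refine sub_eq_zero.1 (h.metric.nondegenerate x _ fun w ↦ ?_)
    obtain ⟨Z, hZ, rfl⟩ := exists_isSmoothField_apply_eq x w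
    have h1 := dirDeriv_const_mul (fieldL F Z) (1 / 2)
      ((contMDiff_pairing h.metric hX hX).mdiffAt x)
    have h2 := congrArg (fun β ↦ β (Z x)) (apply_sharp (γ := fun x ↦ (1 / 2 : ℝ) • γ x)
      (hγ.nondegenerate x)
      ((mvfderiv I (fun y ↦ 1 / 2 * pairing γ X X y) x).comp (prL F x)))
    have h3 := h2.trans h1
    simp only [smul_apply, smul_eq_mul] at h3
    rw [map_sub, sub_apply, h.metric_dorfmanL_self hX, sub_eq_zero]
    refine h3.symm.trans ?_
    rw [algebroidD, map_smul]
    rfl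

theorem isCourantAlgebroid_dorfmanL :
    IsCourantAlgebroid I E (fun x ↦ (1 / 2 : ℝ) • γ x) (prL F) (dorfmanL I γ F) :=
  ⟨h.isMetricAlgebroid_dorfmanL, fun _ _ _ hX hY hZ ↦ h.dorfmanL_leibniz hX hY hZ⟩

theorem isCourantAlgebroid_dorfmanLbar :
    IsCourantAlgebroid I E (fun x ↦ (1 / 2 : ℝ) • γ x) (prLbar F) (dorfmanLbar I γ F) := by
  rw [← prL_neg, ← dorfmanL_neg]
  exact h.neg.isCourantAlgebroid_dorfmanL

theorem metric_starOmega_self {X : Π x : M, TangentSpace I x} (hX : IsSmoothField I X) (x : M)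
    (w : TangentSpace I x) :
    γ x (starOmega I γ F X X x) w = 1 / 2 * mvfderiv I (pairing γ X X) x w := by
  have h1 := h.metric_dorfmanL_self hX x w
  have h2 := h.neg.metric_dorfmanL_self hX x w
  rw [dorfmanL_neg, prL_neg] at h2
  rw [starOmega, Pi.add_apply, map_add, add_apply, h1, h2, ← mul_add, ← map_add, prL_add_prLbar]

theorem starOmega_self {X : Π x : M, TangentSpace I x} (hX : IsSmoothField I X) (x : M) :
    starOmega I γ F X X x = (1 / 2 : ℝ) • metricGrad I γ (fun y ↦ γ y (X y) (X y)) x := by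
  refine sub_eq_zero.1 (h.metric.nondegenerate x _ fun w ↦ ?_)
  rw [map_sub, sub_apply, h.metric_starOmega_self hX, map_smul, metricGrad,
    apply_sharp (h.metric.nondegenerate x), smul_apply, smul_eq_mul, sub_eq_zero]
  rfl

theorem isMetricAlgebroid_starOmega :
    IsMetricAlgebroid I E γ (fun x ↦ ContinuousLinearMap.id ℝ (TangentSpace I x))
      (starOmega I γ F) := by
  have hL := h.isCourantAlgebroid_dorfmanL.metricAlgebroid
  have hLbar := h.isCourantAlgebroid_dorfmanLbar.metricAlgebroid
  refine ⟨h.metric, contMDiff_id_hom, ?_, ?_, ?_, ?_, ?_, ?_, ?_⟩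
  · intro X Y hX hY
    exact isSmoothField_add (hL.star_smooth X Y hX hY) (hLbar.star_smooth X Y hX hY)
  · intro X X' Y hX hX' hY
    simp only [starOmega, hL.star_add_left X X' Y hX hX' hY,
      hLbar.star_add_left X X' Y hX hX' hY]
    abel
  · intro X Y Y' hX hY hY'
    simp only [starOmega, hL.star_add_right X Y Y' hX hY hY',
      hLbar.star_add_right X Y Y' hX hY hY']
    abel
  · intro c X Y hX hY
    simp only [starOmega, hL.star_smul_left c X Y hX hY, hLbar.star_smul_left c X Y hX hY,
      smul_add]
  · intro c X Y hX hY
    simp only [starOmega, hL.star_smul_right c X Y hX hY, hLbar.star_smul_right c X Y hX hY,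
      smul_add]
  · intro X Y Z hX hY hZ x
    have h1 := congrFun (h.dirDeriv_pairing hX hY hZ) x
    have h2 := congrFun (h.neg.dirDeriv_pairing hX hY hZ) x
    have h3 : X x = fieldL F X x + fieldL (fun x ↦ -F x) X x := by
      simp only [fieldL, prL_neg, prL_add_prLbar]
    rw [dorfmanL_neg] at h2
    change mvfderiv I (pairing γ Y Z) x (X x) = _
    rw [h3, map_add]
    refine (congrArg₂ (· + ·) h1 h2).trans ?_
    simp only [starOmega, Pi.add_apply, pairing, map_add, add_apply]
    ring
  · intro X hX x
    exact h.starOmega_self hX x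

/-- The Leibniz identity would make the gradients of all functions `γ(X, X)` null and mutually
orthogonal. -/
theorem mvfderiv_starOmega_self_eq_zero (hl : SatisfiesLeibniz I E (starOmega I γ F))
    {X Y : Π x : M, TangentSpace I x} (hX : IsSmoothField I X) (hY : IsSmoothField I Y) (x : M) :
    mvfderiv I (pairing γ Y Y) x (starOmega I γ F X X x) = 0 := by
  have hm := h.isMetricAlgebroid_starOmega
  have h0 : starOmega I γ F (starOmega I γ F X X) Y = 0 := by
    simpa using hl X X Y hX hX hY
  have hc := hm.compatible (starOmega I γ F X X) Y Y (hm.star_smooth X X hX hX) hY hY x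
  rw [h0] at hc
  refine hc.trans ?_
  simp

/-- At a given point, the differential of `γ(X, X)` can be prescribed: take `X = f V + W` with
`V` in `L`, `W` in `L̄` and `f` vanishing at the point. -/
theorem exists_mvfderiv_pairing_self_eq (x : M) (hE : 0 < Module.finrank ℝ E)
    (α : TangentSpace I x →L[ℝ] ℝ) :
    ∃ X : Π x : M, TangentSpace I x, IsSmoothField I X ∧ mvfderiv I (pairing γ X X) x = α := by
  obtain ⟨v, w, hvw⟩ := h.exists_metric_ne_zero x hE
  obtain ⟨V₀, hV₀, rfl⟩ := exists_isSmoothField_apply_eq x v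
  obtain ⟨W₀, hW₀, rfl⟩ := exists_isSmoothField_apply_eq x w
  let V := fieldL F V₀
  let W := fieldL (fun x ↦ -F x) W₀
  have hV : IsSmoothField I V := h.isSmoothField_fieldL hV₀
  have hW : IsSmoothField I W := h.neg.isSmoothField_fieldL hW₀
  have hk : pairing γ V W x ≠ 0 := by
    simpa only [pairing, V, W, fieldL, prL_neg] using hvw
  obtain ⟨f, hf, hf0, hfα⟩ := exists_mvfderiv_eq x ((2 * pairing γ V W x)⁻¹ • α)
  have hfV := isSmoothField_smul hf hV
  have hp : pairing γ (f • V + W) (f • V + W) = fun y ↦ 2 * (f * pairing γ V W) y := by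
    ext y
    have hVV : γ y (V y) (V y) = 0 := h.metric_eq_zero (h.F_fieldL V₀ y) (h.F_fieldL V₀ y)
    have hWW : γ y (W y) (W y) = 0 :=
      h.neg.metric_eq_zero (h.neg.F_fieldL W₀ y) (h.neg.F_fieldL W₀ y)
    simp only [pairing, Pi.add_apply, Pi.smul_apply', Pi.mul_apply, map_add, map_smul, add_apply,
      smul_apply, smul_eq_mul, hVV, hWW, h.metric.symm y (W y) (V y)]
    ring
  refine ⟨f • V + W, isSmoothField_add hfV hW, ?_⟩
  have hVW := (contMDiff_pairing h.metric hV hW).mdiffAt x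
  ext u
  obtain ⟨U, hU, rfl⟩ := exists_isSmoothField_apply_eq x u
  have hfx : dirDeriv I U f x = (2 * pairing γ V W x)⁻¹ * α (U x) := by
    rw [dirDeriv, hfα]; rfl
  change dirDeriv I U (pairing γ (f • V + W) (f • V + W)) x = α (U x)
  rw [hp, dirDeriv_const_mul U 2 ((hf.mdiffAt x).mul hVW), dirDeriv_mul U (hf.mdiffAt x) hVW, hf0,
    hfx]
  field_simp
  ring

theorem not_satisfiesLeibniz_starOmega (x : M) (hE : 0 < Module.finrank ℝ E) :
    ¬ SatisfiesLeibniz I E (starOmega I γ F) := by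
  intro hl
  have : Nontrivial E := Module.nontrivial_of_finrank_pos hE
  obtain ⟨v, hv⟩ : ∃ v : TangentSpace I x, v ≠ 0 := exists_ne (α := E) 0
  refine hv (h.metric.nondegenerate x v fun w ↦ ?_)
  obtain ⟨X, hX, hXv⟩ := h.exists_mvfderiv_pairing_self_eq x hE (γ x v)
  obtain ⟨Y, hY, hYw⟩ := h.exists_mvfderiv_pairing_self_eq x hE (γ x w)
  have h1 := h.mvfderiv_starOmega_self_eq_zero hl hX hY x
  rw [hYw, h.metric.symm, h.metric_starOmega_self hX, hXv] at h1
  simpa using h1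

end IsParaHermitian

end Algebroids

end

theorem corollary3p1
    {E : Type*} [NormedAddCommGroup E] [NormedSpace ℝ E] [FiniteDimensional ℝ E]
    {H : Type*} [TopologicalSpace H] (I : ModelWithCorners ℝ E H) [I.Boundaryless]
    {M : Type*} [TopologicalSpace M] [T2Space M] [ChartedSpace H M] [IsManifold I ∞ M]
    (γ : Π x : M, TangentSpace I x →L[ℝ] TangentSpace I x →L[ℝ] ℝ)
    (F : Π x : M, TangentSpace I x →L[ℝ] TangentSpace I x)
    (hγF : IsParaHermitian I γ F) :
    -- the two summands of `★_ω` are Dorfman products with metric `γ/2` and anchors `pr_L`, `pr_L̄`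
    IsCourantAlgebroid I E (fun x ↦ (1 / 2 : ℝ) • γ x) (prL F) (dorfmanL I γ F) ∧
    IsCourantAlgebroid I E (fun x ↦ (1 / 2 : ℝ) • γ x) (prLbar F) (dorfmanLbar I γ F) ∧
    (∀ X Y : Π x : M, TangentSpace I x,
      starOmega I γ F X Y = dorfmanL I γ F X Y + dorfmanLbar I γ F X Y) ∧
    -- `(TM, γ, Id, ★_ω)` is a metric algebroid
    IsMetricAlgebroid I E γ (fun x ↦ ContinuousLinearMap.id ℝ (TangentSpace I x))
      (starOmega I γ F) ∧
    (∀ X : Π x : M, TangentSpace I x, IsSmoothField I X → ∀ x,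
      starOmega I γ F X X x
        = (1 / 2 : ℝ) • metricGrad I γ (fun y ↦ γ y (X y) (X y)) x) ∧
    -- `★_ω` is never a Dorfman product, except on a manifold of dimension zero
    (Nonempty M → 0 < Module.finrank ℝ E → ¬ SatisfiesLeibniz I E (starOmega I γ F)) := by
  exact ⟨hγF.isCourantAlgebroid_dorfmanL, hγF.isCourantAlgebroid_dorfmanLbar, fun _ _ ↦ rfl,
    hγF.isMetricAlgebroid_starOmega, fun _ hX x ↦ hγF.starOmega_self hX x,
    fun ⟨x⟩ hE ↦ hγF.not_satisfiesLeibniz_starOmega x hE⟩
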